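/- Theorem 4.4. Let $m \ge n$, $0<k\le\ell<n$, $0\le p\le \ell-k$ and $q\ge 0$ be integers, let $A\in\mathbb{R}^{m\times n}$ have singular value decomposition $A=U\Sigma V^T$, where $U\in\mathbb{R}^{m\times n}$ has orthonormal columns, $V\in\mathbb{R}^{n\times n}$ is orthogonal and $\Sigma=\mathrm{diag}(\sigma_1,\dots,\sigma_n)$ with $\sigma_1\ge\dots\ge\sigma_n\ge 0$, and let $\Omega\in\mathbb{R}^{n\times \ell}$. Write $$V^T\Omega=\begin{pmatrix}\widehat\Omega_1\\ \widehat\Omega_2\end{pmatrix},\qquad \widehat\Omega_1\in\mathbb{R}^{(\ell-p)\times\ell},\quad \widehat\Omega_2\in\mathbb{R}^{(n-\ell+p)\times\ell},$$ and assume that $\widehat\Omega_1$ has full row rank; let $\widehat\Omega_1^\dagger$ be its Moore–Penrose pseudo-inverse. Let $Q$ and $B_k$ be computed by subspace iteration: $Q$ is a matrix with orthonormal columns whose column space contains that of $Y=(AA^T)^qA\Omega$ (for example, an orthonormal basis of the column space of $Y$, or the orthonormal factor of a QR factorization of $Y$), and $B_k$ is a rank-$k$ truncated singular value decomposition of $B=Q^TA$.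 Then $$\|(I-QQ^T)A\|_F\le\|A-QB_k\|_F\le\sqrt{\Big(\sum_{j=k+1}^n\sigma_j^2\Big)+\frac{\alpha^2\|\widehat\Omega_2\|_2^2\|\widehat\Omega_1^\dagger\|_2^2}{1+\gamma^2\|\widehat\Omega_2\|_2^2\|\widehat\Omega_1^\dagger\|_2^2}},$$ $$\|(I-QQ^T)A\|_2\le\|A-QB_k\|_2\le\sqrt{\sigma_{k+1}^2+\frac{\alpha^2\|\widehat\Omega_2\|_2^2\|\widehat\Omega_1^\dagger\|_2^2}{1+\gamma^2\|\widehat\Omega_2\|_2^2\|\widehat\Omega_1^\dagger\|_2^2}},$$ where $$\alpha=\sqrt{k}\,\sigma_{\ell-p+1}\Big(\frac{\sigma_{\ell-p+1}}{\sigma_k}\Big)^{2q},\qquad \gamma=\frac{\sigma_{\ell-p+1}}{\sigma_1}\Big(\frac{\sigma_{\ell-p+1}}{\sigma_k}\Big)^{2q}.$$ (If $\sigma_k=0$ or $\sigma_1=0$, the quotients are of the form $0/0$ and are read as $0$, with $0^0=1$.) -/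

import Mathlib

open scoped Matrix

noncomputable section

namespace SubspaceIteration

open scoped Matrix.Norms.Frobenius in
/-- The Frobenius norm of a real matrix. -/
def frobNorm {ι κ : Type*} [Fintype ι] [Fintype κ] (M : Matrix ι κ ℝ) : ℝ := ‖M‖

open scoped Matrix.Norms.L2Operator in
/-- The 2-norm (spectral norm) of a real matrix. -/
def specNorm {ι κ : Type*} [Fintype ι] [Fintype κ] [DecidableEq κ] (M : Matrix ι κ ℝ) : ℝ := ‖M‖

/-- `A = U * diag(σ) * Vᵀ` is a singular value decomposition: `U` and `V` have orthonormal
columns and `σ` is nonnegative and nonincreasing. The entry `σ i` (indexed from `0`) is the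
`(i+1)`-st largest singular value. For `r = n` the matrix `V` is square, hence orthogonal. -/
structure IsSVD {m n r : ℕ} (A : Matrix (Fin m) (Fin n) ℝ) (U : Matrix (Fin m) (Fin r) ℝ)
    (σ : Fin r → ℝ) (V : Matrix (Fin n) (Fin r) ℝ) : Prop where
  orthonormal_left : Uᵀ * U = 1
  orthonormal_right : Vᵀ * V = 1
  nonneg : ∀ i, 0 ≤ σ i
  antitone : Antitone σ
  eq : A = U * Matrix.diagonal σ * Vᵀ

/-- `Bk` is a rank-`k` truncated SVD of `B`: only the first `k` singular triplets of some
SVD of `B` are kept. (It is not unique when the `k`-th and the `(k+1)`-st singular values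
agree; if `B` has rank at most `k`, it is `B`.) -/
def IsTruncatedSVD {d n : ℕ} (k : ℕ) (B Bk : Matrix (Fin d) (Fin n) ℝ) : Prop :=
  ∃ (r : ℕ) (U : Matrix (Fin d) (Fin r) ℝ) (σ : Fin r → ℝ) (V : Matrix (Fin n) (Fin r) ℝ),
    IsSVD B U σ V ∧
      Bk = U * Matrix.diagonal (fun i : Fin r => if (i : ℕ) < k then σ i else 0) * Vᵀ

/-- `Q` and `Bk` are computed by subspace iteration from `A`, the start matrix `Ω`, the number
of iterations `q` and the target rank `k`: `Q` is an orthonormal column basis for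
`Y = (A * Aᵀ) ^ q * A * Ω`, and `Bk` is a rank-`k` truncated SVD of `B = Qᵀ * A`.
The column space of `Q` is only required to contain that of `Y`, so that, when `Y` has
dependent columns, both an orthonormal basis of its column space (`d < ℓ`) and the orthonormal
factor of a QR factorization `Y = Q * R` (`d = ℓ`) are covered. -/
structure IsOutput {m n d ℓ : ℕ} (A : Matrix (Fin m) (Fin n) ℝ) (Ω : Matrix (Fin n) (Fin ℓ) ℝ)
    (q k : ℕ) (Q : Matrix (Fin m) (Fin d) ℝ) (Bk : Matrix (Fin d) (Fin n) ℝ) : Prop where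
  orthonormal : Qᵀ * Q = 1
  range_le : LinearMap.range ((A * Aᵀ) ^ q * A * Ω).mulVecLin ≤ LinearMap.range Q.mulVecLin
  truncated : IsTruncatedSVD k (Qᵀ * A) Bk

/-- The first `r` rows of a matrix with `n` rows. -/
def topRows {n ℓ : ℕ} (r : ℕ) (M : Matrix (Fin n) (Fin ℓ) ℝ) :
    Matrix {i : Fin n // (i : ℕ) < r} (Fin ℓ) ℝ :=
  M.submatrix Subtype.val id

/-- The remaining rows, all but the first `r`, of a matrix with `n` rows. -/
def bottomRows {n ℓ : ℕ} (r : ℕ) (M : Matrix (Fin n) (Fin ℓ) ℝ) :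
    Matrix {i : Fin n // r ≤ (i : ℕ)} (Fin ℓ) ℝ :=
  M.submatrix Subtype.val id

/-- `N` is the Moore–Penrose pseudo-inverse of the real matrix `M`, characterized by the four
Penrose equations (which have exactly one solution `N` for every `M`). -/
structure IsPseudoInverse {ι κ : Type*} [Fintype ι] [Fintype κ] (M : Matrix ι κ ℝ)
    (N : Matrix κ ι ℝ) : Prop where
  mul_mul_self : M * N * M = M
  self_mul_mul : N * M * N = N
  symm_left : (M * N)ᵀ = M * N
  symm_right : (N * M)ᵀ = N * M

end SubspaceIteration

end

/-! Write `E = A - Q * Bk`, with singular vectors `u_j`, `v_j` of `A`. Since `Q * Bk` is orthogonal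
to `E`, `‖E‖_F² = ‖A‖_F² - ‖Bk‖_F²`. By Ky Fan, `‖Bk‖_F²` is at least `‖Qᵀ A V_k‖_F²`, where `V_k`
holds the leading `k` right singular vectors. So `‖E‖_F²` exceeds the tail of the `σ_j²` by at most
the sum over `j ≤ k` of the squared distances from `σ_j u_j` to the range of `Q`
(`frobSq_sub_mul_le`).

Each distance is bounded by a test vector in the range of `Y` (`IsSVD.residual_le`): for `c = Ω₁†
e_j`, the coordinates of `Y c` along the first `ℓ - p` left singular vectors are those of
`σ_j^(2q+1) u_j`, and the others are damped by powers of `σ_{ℓ-p+1}`. The best multiple of `Y c`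
produces the fraction `x / (1 + x)`, which `residual_bound_le` makes uniform in `j`.

The spectral bound follows from the Frobenius one by a reverse Eckart–Young inequality
(`sub_mul_mulVec_dotProduct_le`). Both lower bounds hold because `1 - Q Qᵀ` is a contraction that
kills `Q`. -/

namespace SubspaceIteration

open Matrix

/-! ### Frobenius and spectral norms, and projections onto column spaces -/

variable {ι κ μ : Type*} [Fintype ι] [Fintype κ] [Fintype μ]

/-- The squared Frobenius norm of a real matrix, as a trace. -/
def frobSq (M : Matrix ι κ ℝ) : ℝ := (Mᵀ * M).trace

lemma frobSq_eq_sum (M : Matrix ι κ ℝ) : frobSq M = ∑ j, ∑ i, M i j ^ 2 := by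
  simp [frobSq, trace, mul_apply, sq]

lemma frobSq_transpose (M : Matrix ι κ ℝ) : frobSq Mᵀ = frobSq M := by
  simp only [frobSq, transpose_transpose]; exact trace_mul_comm _ _

lemma frobNorm_eq_sqrt (M : Matrix ι κ ℝ) : frobNorm M = √(frobSq M) := by
  rw [frobSq_eq_sum, frobNorm, Matrix.frobenius_norm_def, Finset.sum_comm, Real.sqrt_eq_rpow]
  simp

lemma zero_le_dotProduct_self (x : ι → ℝ) : 0 ≤ x ⬝ᵥ x :=
  Finset.sum_nonneg fun _ _ => mul_self_nonneg _

lemma dotProduct_mulVec_self (M : Matrix ι κ ℝ) (x : κ → ℝ) (y : ι → ℝ) :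
    (M *ᵥ x) ⬝ᵥ y = x ⬝ᵥ (Mᵀ *ᵥ y) := by
  rw [dotProduct_comm, dotProduct_mulVec, ← mulVec_transpose, dotProduct_comm]

lemma mulVec_dotProduct_self_of_orthonormal [DecidableEq κ] {Q : Matrix ι κ ℝ} (hQ : Qᵀ * Q = 1)
    (z : κ → ℝ) : (Q *ᵥ z) ⬝ᵥ (Q *ᵥ z) = z ⬝ᵥ z := by
  rw [dotProduct_mulVec_self, mulVec_mulVec, hQ, one_mulVec]

/-- Pythagoras: the squared distance of `u` to a point of the column space of `Q` is at least its
squared distance to the column space. -/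
lemma sub_dotProduct_le_of_orthonormal [DecidableEq κ] {Q : Matrix ι κ ℝ} (hQ : Qᵀ * Q = 1)
    (u : ι → ℝ) (z : κ → ℝ) :
    u ⬝ᵥ u - (Qᵀ *ᵥ u) ⬝ᵥ (Qᵀ *ᵥ u) ≤ (u - Q *ᵥ z) ⬝ᵥ (u - Q *ᵥ z) := by
  have h1 := mulVec_dotProduct_self_of_orthonormal hQ z
  have h2 : (Q *ᵥ z) ⬝ᵥ u = z ⬝ᵥ (Qᵀ *ᵥ u) := dotProduct_mulVec_self _ _ _
  have h3 := zero_le_dotProduct_self (z - Qᵀ *ᵥ u)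
  simp only [sub_dotProduct, dotProduct_sub] at h3 ⊢
  rw [dotProduct_comm u (Q *ᵥ z), h1, h2]
  rw [dotProduct_comm (Qᵀ *ᵥ u) z] at h3
  linarith

lemma transpose_mulVec_dotProduct_le [DecidableEq κ] {Q : Matrix ι κ ℝ} (hQ : Qᵀ * Q = 1)
    (u : ι → ℝ) : (Qᵀ *ᵥ u) ⬝ᵥ (Qᵀ *ᵥ u) ≤ u ⬝ᵥ u := by
  have := zero_le_dotProduct_self (u - Q *ᵥ (Qᵀ *ᵥ u))
  have h1 := mulVec_dotProduct_self_of_orthonormal hQ (Qᵀ *ᵥ u)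
  have h2 : (Q *ᵥ (Qᵀ *ᵥ u)) ⬝ᵥ u = (Qᵀ *ᵥ u) ⬝ᵥ (Qᵀ *ᵥ u) := dotProduct_mulVec_self _ _ _
  simp only [sub_dotProduct, dotProduct_sub] at this
  rw [dotProduct_comm u (Q *ᵥ _), h1, h2] at this
  linarith

lemma one_sub_mulVec_dotProduct_le [DecidableEq ι] [DecidableEq κ] {Q : Matrix ι κ ℝ}
    (hQ : Qᵀ * Q = 1) (u : ι → ℝ) :
    ((1 - Q * Qᵀ) *ᵥ u) ⬝ᵥ ((1 - Q * Qᵀ) *ᵥ u) ≤ u ⬝ᵥ u := by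
  have h1 := mulVec_dotProduct_self_of_orthonormal hQ (Qᵀ *ᵥ u)
  have h2 : (Q *ᵥ (Qᵀ *ᵥ u)) ⬝ᵥ u = (Qᵀ *ᵥ u) ⬝ᵥ (Qᵀ *ᵥ u) := dotProduct_mulVec_self _ _ _
  have h3 := zero_le_dotProduct_self (Qᵀ *ᵥ u)
  rw [sub_mulVec, one_mulVec, ← mulVec_mulVec]
  simp only [sub_dotProduct, dotProduct_sub]
  rw [dotProduct_comm u (Q *ᵥ _), h1, h2]
  linarith

lemma frobSq_eq_sum_dotProduct (M : Matrix ι κ ℝ) : frobSq M = ∑ j, M.col j ⬝ᵥ M.col j := by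
  simp [frobSq_eq_sum, dotProduct, sq, Matrix.col_apply]

lemma col_mul {ι κ μ : Type*} [Fintype κ] (M : Matrix ι κ ℝ) (N : Matrix κ μ ℝ) (j : μ) : (M * N).col j = M *ᵥ N.col j := by
  ext i; simp [mul_apply, mulVec, dotProduct, Matrix.col_apply]

lemma frobSq_mul_of_orthonormal [DecidableEq κ] {Q : Matrix ι κ ℝ} (hQ : Qᵀ * Q = 1)
    (M : Matrix κ μ ℝ) : frobSq (Q * M) = frobSq M := by
  rw [frobSq, frobSq, transpose_mul, Matrix.mul_assoc, ← Matrix.mul_assoc Qᵀ, hQ, Matrix.one_mul]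

lemma frobSq_transpose_mul_le [DecidableEq κ] {Q : Matrix ι κ ℝ} (hQ : Qᵀ * Q = 1)
    (M : Matrix ι μ ℝ) : frobSq (Qᵀ * M) ≤ frobSq M := by
  rw [frobSq_eq_sum_dotProduct, frobSq_eq_sum_dotProduct]
  refine Finset.sum_le_sum fun j _ => ?_
  rw [col_mul]
  exact transpose_mulVec_dotProduct_le hQ _

lemma frobSq_one_sub_mul_le [DecidableEq ι] [DecidableEq κ] {Q : Matrix ι κ ℝ} (hQ : Qᵀ * Q = 1)
    (M : Matrix ι μ ℝ) : frobSq ((1 - Q * Qᵀ) * M) ≤ frobSq M := by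
  rw [frobSq_eq_sum_dotProduct, frobSq_eq_sum_dotProduct]
  refine Finset.sum_le_sum fun j _ => ?_
  rw [col_mul]
  exact one_sub_mulVec_dotProduct_le hQ _

lemma frobSq_of_orthonormal [DecidableEq κ] {Q : Matrix ι κ ℝ} (hQ : Qᵀ * Q = 1) :
    frobSq Q = Fintype.card κ := by
  rw [frobSq, hQ, trace_one]

/-- Pythagoras for the rows of `E`, split by the column space of `W`. -/
lemma frobSq_eq_add_of_orthonormal [DecidableEq ι] [DecidableEq κ] {W : Matrix ι κ ℝ}
    (hW : Wᵀ * W = 1) (E : Matrix μ ι ℝ) :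
    frobSq E = frobSq (E * W) + frobSq (E * (1 - W * Wᵀ)) := by
  rw [← frobSq_transpose E, ← frobSq_transpose (E * W), ← frobSq_transpose (E * (1 - W * Wᵀ))]
  simp only [frobSq, transpose_mul, transpose_transpose, transpose_sub, transpose_one]
  have h : (1 - W * Wᵀ) * (1 - W * Wᵀ) = 1 - W * Wᵀ := by
    have : W * Wᵀ * (W * Wᵀ) = W * Wᵀ := by
      rw [Matrix.mul_assoc, ← Matrix.mul_assoc Wᵀ, hW, Matrix.one_mul]
    rw [Matrix.sub_mul, Matrix.mul_sub, Matrix.mul_sub, this]; simp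
  have h1 : E * (1 - W * Wᵀ) * ((1 - W * Wᵀ) * Eᵀ) = E * Eᵀ - E * W * (Wᵀ * Eᵀ) := by
    rw [Matrix.mul_assoc E, ← Matrix.mul_assoc (1 - W * Wᵀ), h, Matrix.sub_mul, Matrix.mul_sub,
      Matrix.one_mul, Matrix.mul_assoc W, Matrix.mul_assoc E W]
  rw [h1, trace_sub]
  ring

lemma frobSq_mulVec_le (M : Matrix ι κ ℝ) (x : κ → ℝ) :
    (M *ᵥ x) ⬝ᵥ (M *ᵥ x) ≤ frobSq M * (x ⬝ᵥ x) := by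
  rw [frobSq_eq_sum, Finset.sum_comm, Finset.sum_mul]
  refine Finset.sum_le_sum fun i _ => ?_
  have := Finset.sum_mul_sq_le_sq_mul_sq Finset.univ (M i) x
  simpa [mulVec, dotProduct, sq] using this

lemma specNorm_nonneg [DecidableEq κ] (M : Matrix ι κ ℝ) : 0 ≤ specNorm M := by
  unfold specNorm; exact @norm_nonneg _ (Matrix.instL2OpNormedAddCommGroup.toSeminormedAddCommGroup).toSeminormedAddGroup _

lemma norm_toLp_sq (x : ι → ℝ) : ‖(WithLp.toLp 2 x : EuclideanSpace ℝ ι)‖ ^ 2 = x ⬝ᵥ x := by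
  rw [EuclideanSpace.norm_sq_eq]
  simp [dotProduct, sq]

open scoped Matrix.Norms.L2Operator in
lemma mulVec_dotProduct_le_specNorm [DecidableEq κ] (M : Matrix ι κ ℝ) (x : κ → ℝ) :
    (M *ᵥ x) ⬝ᵥ (M *ᵥ x) ≤ specNorm M ^ 2 * (x ⬝ᵥ x) := by
  have h := Matrix.l2_opNorm_mulVec M (WithLp.toLp 2 x)
  have h2 := pow_le_pow_left₀ (norm_nonneg _) h 2
  rw [mul_pow, norm_toLp_sq x] at h2
  rw [← norm_toLp_sq]
  exact h2

open scoped Matrix.Norms.L2Operator in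
lemma specNorm_le_sqrt [DecidableEq κ] (M : Matrix ι κ ℝ) {c : ℝ}
    (h : ∀ x, (M *ᵥ x) ⬝ᵥ (M *ᵥ x) ≤ c * (x ⬝ᵥ x)) : specNorm M ≤ √c := by
  rw [specNorm, Matrix.l2_opNorm_def]
  refine ContinuousLinearMap.opNorm_le_bound _ (Real.sqrt_nonneg _) fun x => ?_
  have h2 := h x.ofLp
  rw [← norm_toLp_sq, ← norm_toLp_sq] at h2
  have h3 := Real.sqrt_le_sqrt h2
  rwa [Real.sqrt_sq (norm_nonneg _), Real.sqrt_mul' _ (sq_nonneg _), Real.sqrt_sq (norm_nonneg _)]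
    at h3

lemma specNorm_one_sub_mul_le [DecidableEq ι] [DecidableEq κ] [DecidableEq μ] {Q : Matrix ι κ ℝ}
    (hQ : Qᵀ * Q = 1) (M : Matrix ι μ ℝ) : specNorm ((1 - Q * Qᵀ) * M) ≤ specNorm M := by
  refine (specNorm_le_sqrt _ (c := specNorm M ^ 2) fun x => ?_).trans
    (Real.sqrt_sq (specNorm_nonneg M)).le
  rw [← mulVec_mulVec]
  exact (one_sub_mulVec_dotProduct_le hQ _).trans (mulVec_dotProduct_le_specNorm M x)

end SubspaceIteration

/-! ### The Ky Fan principle -/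

namespace SubspaceIteration

open Matrix

/-- The total weight is best spent on the largest entries. For `K < r`, comparison with the
threshold `t = a K` gives `(a j - t) * (c j - [j < K]) ≤ 0` for every `j`; summing uses `∑ c ≤ K`
and `t ≥ 0`. -/
lemma sum_mul_le_sum_filter_of_antitone {r K : ℕ} {a c : Fin r → ℝ} (ha : Antitone a)
    (ha0 : ∀ j, 0 ≤ a j) (hc0 : ∀ j, 0 ≤ c j) (hc1 : ∀ j, c j ≤ 1) (hc : ∑ j, c j ≤ K) :
    ∑ j, a j * c j ≤ ∑ j : Fin r, if (j : ℕ) < K then a j else 0 := by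
  rcases le_or_gt r K with hr | hr
  · refine Finset.sum_le_sum fun j _ => ?_
    rw [if_pos (j.2.trans_le hr)]
    exact mul_le_of_le_one_right (ha0 j) (hc1 j)
  · set t := a ⟨K, hr⟩
    have hcard : ∑ j : Fin r, (if (j : ℕ) < K then (1 : ℝ) else 0) = K := by
      rw [Finset.sum_boole, Fin.card_filter_val_lt, min_eq_right hr.le]
    have key : ∀ j : Fin r, a j * c j ≤ (if (j : ℕ) < K then a j else 0)
        + t * (c j - if (j : ℕ) < K then 1 else 0) := by
      intro j
      split_ifs with h
      · have : t ≤ a j := ha (Fin.le_def.2 h.le)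
        nlinarith [hc1 j]
      · have : a j ≤ t := ha (Fin.le_def.2 (not_lt.1 h))
        nlinarith [hc0 j]
    refine (Finset.sum_le_sum fun j _ => key j).trans ?_
    rw [Finset.sum_add_distrib, ← Finset.mul_sum, Finset.sum_sub_distrib, hcard]
    have := mul_nonneg (ha0 ⟨K, hr⟩) (sub_nonneg.2 hc)
    linarith

section SVD

variable {m n r : ℕ} {A : Matrix (Fin m) (Fin n) ℝ} {U : Matrix (Fin m) (Fin r) ℝ}
  {σ : Fin r → ℝ} {V : Matrix (Fin n) (Fin r) ℝ}

lemma IsSVD.sq_antitone (h : IsSVD A U σ V) : Antitone fun j => σ j ^ 2 :=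
  fun _ _ hij => pow_le_pow_left₀ (h.nonneg _) (h.antitone hij) 2

/-- The Ky Fan maximum principle. -/
lemma IsSVD.frobSq_mul_le (h : IsSVD A U σ V) {κ : Type*} [Fintype κ] [DecidableEq κ]
    {W : Matrix (Fin n) κ ℝ} (hW : Wᵀ * W = 1) {K : ℕ} (hK : Fintype.card κ ≤ K) :
    frobSq (A * W) ≤ ∑ j : Fin r, if (j : ℕ) < K then σ j ^ 2 else 0 := by
  -- The weight of `σ j ^ 2` is `|Wᵀ v_j|²`: at most `1` since `v_j` is a unit vector, with total at
  -- most `‖W‖_F² = card κ`.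
  set G := Vᵀ * W
  have h1 : frobSq (A * W) = ∑ j, σ j ^ 2 * ((Gᵀ).col j ⬝ᵥ (Gᵀ).col j) := by
    rw [h.eq, Matrix.mul_assoc, Matrix.mul_assoc, frobSq_mul_of_orthonormal h.orthonormal_left,
      frobSq_eq_sum, Finset.sum_comm]
    refine Finset.sum_congr rfl fun j _ => ?_
    rw [dotProduct, Finset.mul_sum]
    refine Finset.sum_congr rfl fun i _ => ?_
    rw [diagonal_mul, mul_pow, sq (G j i)]
    rfl
  rw [h1]
  refine sum_mul_le_sum_filter_of_antitone h.sq_antitone (fun j => sq_nonneg _)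
    (fun j => zero_le_dotProduct_self _) (fun j => ?_) ?_
  · have h2 : (Gᵀ).col j = Wᵀ *ᵥ V.col j := by
      rw [← col_mul]; simp [G]
    rw [h2]
    refine (transpose_mulVec_dotProduct_le hW _).trans (le_of_eq ?_)
    have := congr_fun (congr_fun h.orthonormal_right j) j
    simpa [mul_apply, dotProduct, col_apply] using this
  · rw [← frobSq_eq_sum_dotProduct, frobSq_transpose]
    refine (frobSq_transpose_mul_le h.orthonormal_right W).trans ?_
    rw [frobSq_of_orthonormal hW]
    exact_mod_cast hK

lemma trace_mul_diagonal_mul (hU : Uᵀ * U = 1) (hV : Vᵀ * V = 1) (a b : Fin r → ℝ) :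
    ((U * diagonal a * Vᵀ)ᵀ * (U * diagonal b * Vᵀ)).trace = ∑ j, a j * b j := by
  have : (U * diagonal a * Vᵀ)ᵀ * (U * diagonal b * Vᵀ)
      = V * (diagonal a * (Uᵀ * U) * diagonal b * Vᵀ) := by
    simp [transpose_mul, Matrix.mul_assoc]
  rw [this, trace_mul_comm, hU, Matrix.mul_one, Matrix.mul_assoc, hV, Matrix.mul_one,
    diagonal_mul_diagonal, trace_diagonal]

lemma IsSVD.frobSq_eq (h : IsSVD A U σ V) : frobSq A = ∑ j, σ j ^ 2 := by
  rw [frobSq, h.eq, trace_mul_diagonal_mul h.orthonormal_left h.orthonormal_right]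
  simp [sq]

lemma IsSVD.mulVec_col (h : IsSVD A U σ V) (j : Fin r) :
    A *ᵥ V.col j = σ j • U.col j := by
  rw [← col_mul, h.eq, Matrix.mul_assoc, h.orthonormal_right, Matrix.mul_one]
  ext i
  simp [col_apply, mul_diagonal, mul_comm]

end SVD

/-- Any finite family of vectors is contained in the span of an orthonormal family which is not
larger. -/
lemma exists_orthonormal_matrix {n : ℕ} {κ : Type*} [Fintype κ] (f : κ → Fin n → ℝ) :
    ∃ (d : ℕ) (W : Matrix (Fin n) (Fin d) ℝ), d ≤ Fintype.card κ ∧ Wᵀ * W = 1 ∧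
      ∀ a, W *ᵥ (Wᵀ *ᵥ f a) = f a := by
  let g : κ → EuclideanSpace ℝ (Fin n) := fun a => WithLp.toLp 2 (f a)
  let S := Submodule.span ℝ (Set.range g)
  let b := stdOrthonormalBasis ℝ S
  have hb : ∀ x y : S, inner ℝ x y = ∑ i, (x : EuclideanSpace ℝ (Fin n)) i
      * (y : EuclideanSpace ℝ (Fin n)) i := by
    intro x y
    rw [Submodule.coe_inner, PiLp.inner_apply]
    simp [mul_comm]
  refine ⟨_, of fun i a => (b a : EuclideanSpace ℝ (Fin n)) i, finrank_range_le_card g, ?_, ?_⟩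
  · ext a c
    have := (orthonormal_iff_ite.1 b.orthonormal) a c
    rw [hb] at this
    simpa [mul_apply, one_apply] using this
  · intro a
    have h := b.sum_repr' ⟨g a, Submodule.subset_span ⟨a, rfl⟩⟩
    ext i
    have h2 := congrArg (fun x : S => (x : EuclideanSpace ℝ (Fin n)) i) h
    simp only [hb] at h2
    simp only [Submodule.coe_sum, Submodule.coe_smul, WithLp.ofLp_sum, Finset.sum_apply,
      PiLp.smul_apply, smul_eq_mul] at h2
    simp only [mulVec, dotProduct, transpose_apply, of_apply]
    refine Eq.trans ?_ h2
    exact Finset.sum_congr rfl fun _ _ => mul_comm _ _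

/-! ### Truncated SVDs and the reverse Eckart–Young inequality -/

section Output

variable {m n d k : ℕ} {A : Matrix (Fin m) (Fin n) ℝ} {Q : Matrix (Fin m) (Fin d) ℝ}
  {B Bk : Matrix (Fin d) (Fin n) ℝ}

/-- `Bk` keeps some singular triplets of `Qᵀ * A`, so `⟨A, Q Bk⟩ = ⟨Qᵀ A, Bk⟩ = ‖Bk‖_F²`, which is
also `‖Q Bk‖_F²`. -/
lemma frobSq_sub_mul_of_isTruncatedSVD (hQ : Qᵀ * Q = 1) (h : IsTruncatedSVD k (Qᵀ * A) Bk) :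
    frobSq (A - Q * Bk) = frobSq A - frobSq Bk := by
  obtain ⟨r, U, σ, V, hB, rfl⟩ := h
  set Bk := U * diagonal (fun i : Fin r => if (i : ℕ) < k then σ i else 0) * Vᵀ
  have h1 : ((Qᵀ * A)ᵀ * Bk).trace = frobSq Bk := by
    rw [hB.eq, frobSq, trace_mul_diagonal_mul hB.orthonormal_left hB.orthonormal_right,
      trace_mul_diagonal_mul hB.orthonormal_left hB.orthonormal_right]
    exact Finset.sum_congr rfl fun j _ => by split_ifs <;> simp
  have h2 : (Aᵀ * (Q * Bk)).trace = frobSq Bk := by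
    rw [← h1, transpose_mul, transpose_transpose, Matrix.mul_assoc]
  have h3 : ((Q * Bk)ᵀ * A).trace = frobSq Bk := by
    rw [← h2, ← trace_transpose, transpose_mul, transpose_transpose]
  have h4 : ((Q * Bk)ᵀ * (Q * Bk)).trace = frobSq Bk := frobSq_mul_of_orthonormal hQ Bk
  rw [frobSq, transpose_sub, Matrix.sub_mul, Matrix.mul_sub, Matrix.mul_sub, trace_sub, trace_sub,
    trace_sub, h2, h3, h4, frobSq, frobSq]
  ring

lemma IsTruncatedSVD.frobSq_mul_le (h : IsTruncatedSVD k B Bk) {κ : Type*} [Fintype κ]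
    [DecidableEq κ] {W : Matrix (Fin n) κ ℝ} (hW : Wᵀ * W = 1) (hK : Fintype.card κ ≤ k) :
    frobSq (B * W) ≤ frobSq Bk := by
  obtain ⟨r, U, σ, V, hB, rfl⟩ := h
  refine (hB.frobSq_mul_le hW hK).trans_eq ?_
  rw [frobSq, trace_mul_diagonal_mul hB.orthonormal_left hB.orthonormal_right]
  exact Finset.sum_congr rfl fun j _ => by split_ifs <;> simp [sq]

/-- A truncated SVD and one more vector have a row space of dimension at most `k + 1`. -/
lemma IsTruncatedSVD.exists_orthonormal (h : IsTruncatedSVD k B Bk) (v : Fin n → ℝ) :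
    ∃ (s : ℕ) (W : Matrix (Fin n) (Fin s) ℝ), s ≤ k + 1 ∧ Wᵀ * W = 1 ∧
      W *ᵥ (Wᵀ *ᵥ v) = v ∧ Bk * (1 - W * Wᵀ) = 0 := by
  obtain ⟨r, U, σ, V, hB, rfl⟩ := h
  -- The index `none` carries `v`; the others carry the at most `k` right singular vectors that are
  -- kept.
  obtain ⟨s, W, hs, hW, hf⟩ := exists_orthonormal_matrix
    (fun o : Option {j : Fin r // (j : ℕ) < k} => o.elim v fun j => V.col j)
  refine ⟨s, W, hs.trans ?_, hW, hf none, ?_⟩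
  · rw [Fintype.card_option, Fintype.card_subtype, Fin.card_filter_val_lt]
    omega
  · rw [← transpose_inj]
    have : (1 - W * Wᵀ) * (V * diagonal fun i : Fin r => if (i : ℕ) < k then σ i else 0) = 0 := by
      rw [← Matrix.mul_assoc]
      ext i j
      rw [mul_diagonal]
      split_ifs with hj
      · have h1 := hf (some ⟨j, hj⟩)
        have h2 : ((1 - W * Wᵀ) * V).col j = 0 := by
          rw [col_mul, sub_mulVec, one_mulVec, ← mulVec_mulVec]
          exact sub_eq_zero.2 h1.symm
        have h3 := congr_fun h2 i
        rw [col_apply, Pi.zero_apply] at h3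
        rw [h3, zero_mul, Matrix.zero_apply]
      · simp
    simp only [transpose_mul, transpose_sub, transpose_one, transpose_transpose,
      diagonal_transpose, transpose_zero]
    rw [← Matrix.mul_assoc V, ← Matrix.mul_assoc, this, Matrix.zero_mul]

/-- The reverse Eckart–Young inequality: an error of a rank-`k` approximation which is small in the
Frobenius norm is small in the spectral norm. -/
lemma sub_mul_mulVec_dotProduct_le {r : ℕ} {U : Matrix (Fin m) (Fin r) ℝ} {σ : Fin r → ℝ}
    {V : Matrix (Fin n) (Fin r) ℝ} (hA : IsSVD A U σ V) (h : IsTruncatedSVD k B Bk)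
    (P : Matrix (Fin m) (Fin d) ℝ) (v : Fin n → ℝ) :
    ((A - P * Bk) *ᵥ v) ⬝ᵥ ((A - P * Bk) *ᵥ v)
      ≤ (frobSq (A - P * Bk) - ∑ j : Fin r, if (j : ℕ) < k + 1 then 0 else σ j ^ 2)
        * (v ⬝ᵥ v) := by
  obtain ⟨s, W, hs, hW, hWv, hz⟩ := h.exists_orthonormal v
  have h1 := frobSq_mulVec_le ((A - P * Bk) * W) (Wᵀ *ᵥ v)
  rw [← mulVec_mulVec, hWv, ← mulVec_dotProduct_self_of_orthonormal hW, hWv] at h1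
  refine h1.trans (mul_le_mul_of_nonneg_right ?_ (zero_le_dotProduct_self v))
  -- On the complement of the range of `W` the error is that of `A` alone, and by Ky Fan `k + 1`
  -- directions leave at least the tail of the `σ j ^ 2` there.
  rw [frobSq_eq_add_of_orthonormal hW (A - P * Bk), Matrix.sub_mul (N := (1 - W * Wᵀ)),
    Matrix.mul_assoc P Bk, hz, Matrix.mul_zero, sub_zero]
  have h2 := frobSq_eq_add_of_orthonormal hW A
  have h3 := hA.frobSq_mul_le hW (K := k + 1) (by simpa using hs)
  rw [hA.frobSq_eq] at h2
  have h4 : ∑ j, σ j ^ 2 = (∑ j : Fin r, if (j : ℕ) < k + 1 then σ j ^ 2 else 0)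
      + ∑ j : Fin r, if (j : ℕ) < k + 1 then 0 else σ j ^ 2 := by
    rw [← Finset.sum_add_distrib]
    exact Finset.sum_congr rfl fun j _ => by split_ifs <;> simp
  linarith

end Output

end SubspaceIteration

/-! ### Distance from the leading left singular vectors to the range of `Q` -/

namespace SubspaceIteration

open Matrix

/-- Full row rank makes every basis vector some `M x`, and `M N` fixes `M x`. -/
lemma IsPseudoInverse.mul_eq_one_of_rank {ι κ : Type*} [Fintype ι] [Fintype κ] [DecidableEq ι]
    {M : Matrix ι κ ℝ} {N : Matrix κ ι ℝ} (h : IsPseudoInverse M N)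
    (hM : M.rank = Fintype.card ι) : M * N = 1 := by
  have hsurj : LinearMap.range M.mulVecLin = ⊤ := by
    apply Submodule.eq_top_of_finrank_eq
    rw [Module.finrank_fintype_fun_eq_card]
    exact hM
  refine ext_of_mulVec_single fun i => ?_
  obtain ⟨x, hx⟩ := LinearMap.range_eq_top.1 hsurj (Pi.single i 1)
  rw [mulVecLin_apply] at hx
  rw [← hx, mulVec_mulVec, h.mul_mul_self, one_mulVec]

section

variable {m n d ℓ r q : ℕ} {A : Matrix (Fin m) (Fin n) ℝ} {U : Matrix (Fin m) (Fin r) ℝ}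
  {σ : Fin r → ℝ} {V : Matrix (Fin n) (Fin r) ℝ}

lemma IsSVD.pow_mul_eq (h : IsSVD A U σ V) (q : ℕ) :
    (A * Aᵀ) ^ q * A = U * diagonal (fun i => σ i ^ (2 * q + 1)) * Vᵀ := by
  have h2 : A * Aᵀ = U * (diagonal (fun i => σ i ^ 2) * Uᵀ) := by
    conv_lhs => rw [h.eq]
    simp only [transpose_mul, transpose_transpose, diagonal_transpose, Matrix.mul_assoc]
    rw [← Matrix.mul_assoc Vᵀ, h.orthonormal_right, Matrix.one_mul,
      ← Matrix.mul_assoc (diagonal σ), diagonal_mul_diagonal]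
    simp [sq]
  induction q with
  | zero => simpa using h.eq
  | succ q ih =>
    rw [pow_succ', Matrix.mul_assoc, ih, h2]
    simp only [Matrix.mul_assoc]
    rw [← Matrix.mul_assoc Uᵀ, h.orthonormal_left, Matrix.one_mul,
      ← Matrix.mul_assoc (diagonal _) (diagonal _), diagonal_mul_diagonal]
    congr! 4
    ring

/-- `1 / (y * (1 + x))` is the minimizer over `t` of `(a - t y a)² + t² x (y a)²`, and the right
side is the minimum. -/
lemma residual_scalar_eq {a y x : ℝ} (hy : 0 < y) (hx : 0 ≤ x) :
    (a - 1 / (y * (1 + x)) * (y * a)) ^ 2 + (1 / (y * (1 + x))) ^ 2 * (x * (y * a) ^ 2)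
      = a ^ 2 * (x / (1 + x)) := by
  have : 1 + x ≠ 0 := by positivity
  field_simp
  ring

/-- The part of `σ j • U.col j` outside the column space of `Q` is small, if that space contains a
vector whose coordinates with respect to the leading left singular vectors are those of
`U.col j`. -/
lemma IsSVD.residual_le (h : IsSVD A U σ V) {Ω : Matrix (Fin n) (Fin ℓ) ℝ}
    {Q : Matrix (Fin m) (Fin d) ℝ} (hQ : Qᵀ * Q = 1)
    (hr : LinearMap.range ((A * Aᵀ) ^ q * A * Ω).mulVecLin ≤ LinearMap.range Q.mulVecLin)
    (b j : Fin r) (hjb : j < b) (hj : 0 < σ j) (c : Fin ℓ → ℝ)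
    (hc : ∀ i < b, ((Vᵀ * Ω) *ᵥ c) i = if i = j then 1 else 0) {T : ℝ}
    (hT : (∑ i, if b ≤ i then ((Vᵀ * Ω) *ᵥ c) i ^ 2 else 0) ≤ T) :
    σ j ^ 2 - (Qᵀ *ᵥ (σ j • U.col j)) ⬝ᵥ (Qᵀ *ᵥ (σ j • U.col j))
      ≤ σ j ^ 2 * ((σ b / σ j) ^ (4 * q + 2) * T / (1 + (σ b / σ j) ^ (4 * q + 2) * T)) := by
  have hT0 : 0 ≤ T := le_trans (Finset.sum_nonneg fun i _ => by positivity) hT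
  have hb := h.nonneg b
  set g := (Vᵀ * Ω) *ᵥ c with hg
  set x := (σ b / σ j) ^ (4 * q + 2) * T with hx
  have hx0 : 0 ≤ x := by positivity
  -- The optimal multiple of `Y c`, from `residual_scalar_eq` with `y = σ j ^ (2 * q)`.
  set t := 1 / (σ j ^ (2 * q) * (1 + x)) with ht
  obtain ⟨z, hz⟩ := hr ⟨t • c, rfl⟩
  simp only [mulVecLin_apply] at hz
  have hY : Q *ᵥ z = U *ᵥ (fun i => t * (σ i ^ (2 * q + 1) * g i)) := by
    rw [hz, h.pow_mul_eq, Matrix.mul_assoc, ← mulVec_mulVec, ← mulVec_mulVec,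
      mulVec_smul, ← hg]
    congr 1
    ext i
    simp [mulVec_diagonal]
    ring
  have hu : σ j • U.col j = U *ᵥ (Pi.single j (σ j)) := by
    ext i; simp [col_apply, mul_comm]
  have hn : (σ j • U.col j) ⬝ᵥ (σ j • U.col j) = σ j ^ 2 := by
    rw [hu, mulVec_dotProduct_self_of_orthonormal h.orthonormal_left]
    simp [sq]
  have h1 := sub_dotProduct_le_of_orthonormal hQ (σ j • U.col j) z
  rw [hn, hY] at h1
  refine h1.trans ?_
  rw [hu, ← mulVec_sub, mulVec_dotProduct_self_of_orthonormal h.orthonormal_left]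
  have hterm : ∀ i, ((Pi.single j (σ j) : Fin r → ℝ) - fun i => t * (σ i ^ (2 * q + 1) * g i)) i
      * ((Pi.single j (σ j) : Fin r → ℝ) - fun i => t * (σ i ^ (2 * q + 1) * g i)) i
      ≤ (if i = j then (σ j - t * (σ j ^ (2 * q) * σ j)) ^ 2 else 0)
        + t ^ 2 * σ b ^ (4 * q + 2) * (if b ≤ i then g i ^ 2 else 0) := by
    intro i
    rw [Pi.sub_apply]
    rcases lt_or_ge i b with hi | hi
    · rw [if_neg (not_le.2 hi), hc i hi]
      rcases eq_or_ne i j with rfl | hij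
      · simp [pow_succ]
      · simp [hij]
    · have hij : i ≠ j := (hjb.trans_le hi).ne'
      rw [if_pos hi, if_neg hij, Pi.single_eq_of_ne hij]
      have h2 : σ i ^ (4 * q + 2) ≤ σ b ^ (4 * q + 2) :=
        pow_le_pow_left₀ (h.nonneg i) (h.antitone hi) _
      have h3 : σ i ^ (4 * q + 2) = (σ i ^ (2 * q + 1)) ^ 2 := by ring
      have h4 := mul_le_mul_of_nonneg_left h2 (by positivity : 0 ≤ t ^ 2 * g i ^ 2)
      rw [h3] at h4
      linarith
  refine (Finset.sum_le_sum fun i _ => hterm i).trans ?_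
  rw [Finset.sum_add_distrib, ← Finset.mul_sum, Finset.sum_ite_eq' Finset.univ j,
    if_pos (Finset.mem_univ j)]
  have h5 : σ b ^ (4 * q + 2) * T = x * (σ j ^ (2 * q) * σ j) ^ 2 := by
    rw [hx, div_pow]
    field_simp
    ring
  have h6 := residual_scalar_eq (a := σ j) (pow_pos hj (2 * q)) hx0
  rw [← ht, ← h5] at h6
  rw [← h6]
  have h7 := mul_le_mul_of_nonneg_left hT (by positivity : 0 ≤ t ^ 2 * σ b ^ (4 * q + 2))
  linarith

/-- The factor `a²` cancels against `(s / a)²`, leaving `s² y / (1 + (s / a)² y)`. This increases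
with `y` and decreases with `s / a`, so `a` may be replaced by `b` inside `y` and by `c` in the
denominator. If `s = 0`, both sides vanish, even for `b = 0`. -/
lemma residual_bound_le {s a b c T : ℝ} (hs : 0 ≤ s) (hsb : s ≤ b) (hba : b ≤ a)
    (hac : a ≤ c) (hT : 0 ≤ T) (ha : 0 < a) (q : ℕ) :
    a ^ 2 * ((s / a) ^ (4 * q + 2) * T / (1 + (s / a) ^ (4 * q + 2) * T))
      ≤ (s * (s / b) ^ (2 * q)) ^ 2 * T / (1 + (s / c * (s / b) ^ (2 * q)) ^ 2 * T) := by
  rcases hs.eq_or_lt with rfl | hs0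
  · simp
  have hb : 0 < b := hs0.trans_le hsb
  have hc : 0 < c := ha.trans_le hac
  have h1 : (s / a) ^ (2 * q) ≤ (s / b) ^ (2 * q) := by gcongr
  have h2 : ((s / a) ^ (2 * q)) ^ 2 * T ≤ ((s / b) ^ (2 * q)) ^ 2 * T := by gcongr
  have h3 : (s / c) ^ 2 ≤ (s / a) ^ 2 := by gcongr
  have h4 : a ^ 2 * (s / a) ^ 2 = s ^ 2 := by field_simp
  have h5 : (s / a) ^ (4 * q + 2) * T = (s / a) ^ 2 * (((s / a) ^ (2 * q)) ^ 2 * T) := by ring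
  have hy0 : 0 ≤ ((s / a) ^ (2 * q)) ^ 2 * T := by positivity
  rw [h5, mul_pow, mul_pow, mul_assoc (s ^ 2), mul_assoc ((s / c) ^ 2), mul_div_assoc (s ^ 2),
    mul_div_assoc ((s / a) ^ 2), ← mul_assoc, h4]
  generalize ((s / a) ^ (2 * q)) ^ 2 * T = y at *
  generalize ((s / b) ^ (2 * q)) ^ 2 * T = Y at *
  have hY0 := hy0.trans h2
  refine mul_le_mul_of_nonneg_left ?_ (sq_nonneg s)
  rw [div_le_div_iff₀ (by positivity) (by positivity)]
  have := mul_le_mul_of_nonneg_right h3 (mul_nonneg hy0 hY0)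
  nlinarith

end

/-- A bound for the Frobenius error of subspace iteration from bounds for the parts of the leading
left singular vectors outside the column space of `Q`. -/
lemma frobSq_sub_mul_le {m n d k : ℕ} {A : Matrix (Fin m) (Fin n) ℝ} {U : Matrix (Fin m) (Fin n) ℝ}
    {σ : Fin n → ℝ} {V : Matrix (Fin n) (Fin n) ℝ} (h : IsSVD A U σ V)
    {Q : Matrix (Fin m) (Fin d) ℝ} {Bk : Matrix (Fin d) (Fin n) ℝ} (hQ : Qᵀ * Q = 1)
    (hB : IsTruncatedSVD k (Qᵀ * A) Bk) (hkn : k ≤ n) {δ : ℝ}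
    (hδ : ∀ j : Fin n, (j : ℕ) < k →
      σ j ^ 2 - (Qᵀ *ᵥ (σ j • U.col j)) ⬝ᵥ (Qᵀ *ᵥ (σ j • U.col j)) ≤ δ) :
    frobSq (A - Q * Bk)
      ≤ (∑ j ∈ Finset.univ.filter (fun j : Fin n => k ≤ (j : ℕ)), σ j ^ 2) + k * δ := by
  -- The leading right singular vectors of `A` serve as trial vectors in Ky Fan for `Qᵀ * A`.
  let W : Matrix (Fin n) {j : Fin n // (j : ℕ) < k} ℝ := V.submatrix id Subtype.val
  have hcard : Fintype.card {j : Fin n // (j : ℕ) < k} = k := by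
    rw [Fintype.card_subtype, Fin.card_filter_val_lt, min_eq_right hkn]
  have hW : Wᵀ * W = 1 := by
    have : Wᵀ * W = (Vᵀ * V).submatrix Subtype.val Subtype.val := by
      ext i j; simp [W, mul_apply]
    rw [this, h.orthonormal_right, submatrix_one _ Subtype.val_injective]
  have h1 := hB.frobSq_mul_le hW hcard.le
  have h2 : frobSq (Qᵀ * A * W) = ∑ j : {j : Fin n // (j : ℕ) < k},
      (Qᵀ *ᵥ (σ j • U.col j)) ⬝ᵥ (Qᵀ *ᵥ (σ j • U.col j)) := by
    rw [frobSq_eq_sum_dotProduct]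
    refine Finset.sum_congr rfl fun j _ => ?_
    have : W.col j = V.col j := rfl
    rw [col_mul, ← mulVec_mulVec, this, h.mulVec_col]
  have h3 : ∑ j : {j : Fin n // (j : ℕ) < k}, (σ j ^ 2 - δ) ≤ frobSq (Qᵀ * A * W) := by
    rw [h2]
    exact Finset.sum_le_sum fun j _ => by linarith [hδ j j.2]
  rw [Finset.sum_sub_distrib, Finset.sum_const, Finset.card_univ, hcard, nsmul_eq_mul] at h3
  have h4 : ∑ j, σ j ^ 2 = (∑ j : {j : Fin n // (j : ℕ) < k}, σ j ^ 2)
      + ∑ j ∈ Finset.univ.filter (fun j : Fin n => k ≤ (j : ℕ)), σ j ^ 2 := by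
    rw [← Finset.sum_filter_add_sum_filter_not Finset.univ (fun j : Fin n => (j : ℕ) < k)]
    simp only [not_lt]
    congr 1
    exact (Finset.sum_subtype _ (by simp) _)
  rw [frobSq_sub_mul_of_isTruncatedSVD hQ hB, h.frobSq_eq]
  linarith

lemma mul_one_sub_mul_eq {m n d : ℕ} (A : Matrix (Fin m) (Fin n) ℝ) {Q : Matrix (Fin m) (Fin d) ℝ}
    (hQ : Qᵀ * Q = 1) (B : Matrix (Fin d) (Fin n) ℝ) :
    (1 - Q * Qᵀ) * A = (1 - Q * Qᵀ) * (A - Q * B) := by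
  rw [Matrix.mul_sub, ← Matrix.mul_assoc, Matrix.sub_mul 1 _ Q, Matrix.mul_assoc Q Qᵀ Q, hQ]
  simp

end SubspaceIteration

/-! ### The error bounds -/

open SubspaceIteration Matrix in
theorem theorem4p4 {m n d ℓ : ℕ} (k p q : ℕ)
    (hk : 0 < k) (hkp : k + p ≤ ℓ) (hℓ : ℓ < n)
    (A : Matrix (Fin m) (Fin n) ℝ) (Ω : Matrix (Fin n) (Fin ℓ) ℝ)
    -- the SVD of `A`; `σ` is indexed from `0`, and `U` being `m × n` forces `n ≤ m`
    (U : Matrix (Fin m) (Fin n) ℝ) (σ : Fin n → ℝ) (V : Matrix (Fin n) (Fin n) ℝ)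
    (hA : SubspaceIteration.IsSVD A U σ V)
    -- the two row blocks of `Vᵀ * Ω`, the first of full row rank
    (Ω₁ : Matrix {i : Fin n // (i : ℕ) < ℓ - p} (Fin ℓ) ℝ)
    (hΩ₁ : Ω₁ = SubspaceIteration.topRows (ℓ - p) (Vᵀ * Ω))
    (Ω₂ : Matrix {i : Fin n // ℓ - p ≤ (i : ℕ)} (Fin ℓ) ℝ)
    (hΩ₂ : Ω₂ = SubspaceIteration.bottomRows (ℓ - p) (Vᵀ * Ω))
    (hrank : Ω₁.rank = ℓ - p)
    (Ω₁pinv : Matrix (Fin ℓ) {i : Fin n // (i : ℕ) < ℓ - p} ℝ)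
    (hpinv : SubspaceIteration.IsPseudoInverse Ω₁ Ω₁pinv)
    -- the output of subspace iteration
    (Q : Matrix (Fin m) (Fin d) ℝ) (Bk : Matrix (Fin d) (Fin n) ℝ)
    (hout : SubspaceIteration.IsOutput A Ω q k Q Bk)
    (α γ : ℝ)
    (hα : α = √(k : ℝ) * σ ⟨ℓ - p, by omega⟩
      * (σ ⟨ℓ - p, by omega⟩ / σ ⟨k - 1, by omega⟩) ^ (2 * q))
    (hγ : γ = (σ ⟨ℓ - p, by omega⟩ / σ ⟨0, by omega⟩)
      * (σ ⟨ℓ - p, by omega⟩ / σ ⟨k - 1, by omega⟩) ^ (2 * q)) :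
    (SubspaceIteration.frobNorm ((1 - Q * Qᵀ) * A)
        ≤ SubspaceIteration.frobNorm (A - Q * Bk) ∧
      SubspaceIteration.frobNorm (A - Q * Bk)
        ≤ √((∑ j ∈ Finset.univ.filter (fun j : Fin n => k ≤ (j : ℕ)), σ j ^ 2)
          + α ^ 2 * SubspaceIteration.specNorm Ω₂ ^ 2 * SubspaceIteration.specNorm Ω₁pinv ^ 2
            / (1 + γ ^ 2 * SubspaceIteration.specNorm Ω₂ ^ 2
                * SubspaceIteration.specNorm Ω₁pinv ^ 2))) ∧
    (SubspaceIteration.specNorm ((1 - Q * Qᵀ) * A)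
        ≤ SubspaceIteration.specNorm (A - Q * Bk) ∧
      SubspaceIteration.specNorm (A - Q * Bk)
        ≤ √(σ ⟨k, by omega⟩ ^ 2
          + α ^ 2 * SubspaceIteration.specNorm Ω₂ ^ 2 * SubspaceIteration.specNorm Ω₁pinv ^ 2
            / (1 + γ ^ 2 * SubspaceIteration.specNorm Ω₂ ^ 2
                * SubspaceIteration.specNorm Ω₁pinv ^ 2))) := by
  have hQ := hout.orthonormal
  have hT0 : 0 ≤ specNorm Ω₂ ^ 2 * specNorm Ω₁pinv ^ 2 := by positivity
  have hone : Ω₁ * Ω₁pinv = 1 := by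
    refine hpinv.mul_eq_one_of_rank ?_
    rw [hrank, Fintype.card_subtype, Fin.card_filter_val_lt, min_eq_right (by omega)]
  have hres : ∀ j : Fin n, (j : ℕ) < k →
      σ j ^ 2 - (Qᵀ *ᵥ (σ j • U.col j)) ⬝ᵥ (Qᵀ *ᵥ (σ j • U.col j))
        ≤ (σ ⟨ℓ - p, by omega⟩ * (σ ⟨ℓ - p, by omega⟩ / σ ⟨k - 1, by omega⟩) ^ (2 * q)) ^ 2
          * (specNorm Ω₂ ^ 2 * specNorm Ω₁pinv ^ 2)
          / (1 + γ ^ 2 * (specNorm Ω₂ ^ 2 * specNorm Ω₁pinv ^ 2)) := by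
    intro j hj
    -- For `σ j = 0` there is nothing to approximate; otherwise division by `σ j` is legitimate.
    rcases (hA.nonneg j).eq_or_lt with h0 | hpos
    · rw [← h0]
      simp only [zero_smul, mulVec_zero, dotProduct_zero, sub_zero]
      rw [zero_pow two_ne_zero]
      positivity
    set c := Ω₁pinv *ᵥ Pi.single ⟨j, by omega⟩ 1 with hc
    have hcc : c ⬝ᵥ c ≤ specNorm Ω₁pinv ^ 2 := by
      refine (mulVec_dotProduct_le_specNorm Ω₁pinv _).trans_eq ?_
      simp
    have htop : ∀ i < (⟨ℓ - p, by omega⟩ : Fin n), ((Vᵀ * Ω) *ᵥ c) i = if i = j then 1 else 0 := by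
      intro i hi
      have h1 : Ω₁ *ᵥ c = Pi.single ⟨j, by omega⟩ 1 := by rw [hc, mulVec_mulVec, hone, one_mulVec]
      have h2 := congr_fun h1 ⟨i, hi⟩
      rw [hΩ₁, Pi.single_apply] at h2
      simp only [Subtype.mk.injEq] at h2
      exact h2
    have hbot : (∑ i, if (⟨ℓ - p, by omega⟩ : Fin n) ≤ i then ((Vᵀ * Ω) *ᵥ c) i ^ 2 else 0)
        ≤ specNorm Ω₂ ^ 2 * specNorm Ω₁pinv ^ 2 := by
      refine le_trans (le_of_eq ?_) ((mulVec_dotProduct_le_specNorm Ω₂ c).trans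
        (mul_le_mul_of_nonneg_left hcc (sq_nonneg _)))
      rw [← Finset.sum_filter, Finset.sum_subtype (p := fun i : Fin n => ℓ - p ≤ (i : ℕ)) _
        (fun i => by simp [Fin.le_def]), dotProduct, hΩ₂]
      exact Finset.sum_congr rfl fun i _ => sq _
    refine (hA.residual_le hQ hout.range_le ⟨ℓ - p, by omega⟩ j (Fin.lt_def.2 (by simp; omega)) hpos
      c htop hbot).trans ?_
    rw [hγ]
    exact residual_bound_le (hA.nonneg _) (hA.antitone (Fin.le_def.2 (by simp; omega)))
      (hA.antitone (Fin.le_def.2 (by simp; omega))) (hA.antitone (Fin.le_def.2 (by simp)))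
      hT0 hpos q
  have hfrob := frobSq_sub_mul_le hA hQ hout.truncated (by omega) hres
  -- The `√k` in `α` pays for adding `k` equal bounds.
  have hη : (k : ℝ) * ((σ ⟨ℓ - p, by omega⟩
        * (σ ⟨ℓ - p, by omega⟩ / σ ⟨k - 1, by omega⟩) ^ (2 * q)) ^ 2
        * (specNorm Ω₂ ^ 2 * specNorm Ω₁pinv ^ 2)
        / (1 + γ ^ 2 * (specNorm Ω₂ ^ 2 * specNorm Ω₁pinv ^ 2)))
      = α ^ 2 * specNorm Ω₂ ^ 2 * specNorm Ω₁pinv ^ 2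
        / (1 + γ ^ 2 * specNorm Ω₂ ^ 2 * specNorm Ω₁pinv ^ 2) := by
    rw [hα, mul_assoc (√(k : ℝ)), mul_pow (√(k : ℝ)), Real.sq_sqrt (Nat.cast_nonneg k)]
    ring
  rw [hη] at hfrob
  refine ⟨⟨?_, ?_⟩, ?_, ?_⟩
  · rw [mul_one_sub_mul_eq A hQ Bk, frobNorm_eq_sqrt, frobNorm_eq_sqrt]
    exact Real.sqrt_le_sqrt (frobSq_one_sub_mul_le hQ _)
  · rw [frobNorm_eq_sqrt]
    exact Real.sqrt_le_sqrt hfrob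
  · rw [mul_one_sub_mul_eq A hQ Bk]
    exact specNorm_one_sub_mul_le hQ _
  · refine specNorm_le_sqrt _ fun x => (sub_mul_mulVec_dotProduct_le hA hout.truncated Q x).trans
      (mul_le_mul_of_nonneg_right ?_ (zero_le_dotProduct_self x))
    -- The reverse Eckart–Young inequality subtracts the tail after index `k` (from `0`), so of the
    -- Frobenius tail only `σ_{k+1}²` survives.
    have hsum : ∑ j ∈ Finset.univ.filter (fun j : Fin n => k ≤ (j : ℕ)), σ j ^ 2
        = σ ⟨k, by omega⟩ ^ 2 + ∑ j : Fin n, if (j : ℕ) < k + 1 then 0 else σ j ^ 2 := by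
      rw [Finset.sum_filter, ← Finset.add_sum_erase _ _ (Finset.mem_univ (⟨k, by omega⟩ : Fin n)),
        ← Finset.add_sum_erase (f := fun j : Fin n => if (j : ℕ) < k + 1 then 0 else σ j ^ 2) _
          (Finset.mem_univ (⟨k, by omega⟩ : Fin n))]
      simp only [le_refl, if_true, Nat.lt_succ_self, zero_add]
      congr 1
      refine Finset.sum_congr rfl fun j hj => ?_
      have hne : (j : ℕ) ≠ k := fun h => (Finset.mem_erase.1 hj).1 (Fin.ext h)
      split_ifs <;> first | rfl | omega
    linarith
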